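/- \textbf{Setting.} Let $(S,\mathcal S)$ be a measurable space and let $(P_t)_{t\ge 0}$ be Markov kernels on $S$; write $P_{t,x}(t+m,\cdot)$ for the transition probability from time $t$ to time $t+m$ of the non-homogeneous Markov chain with one-step kernels $P_0,P_1,\dots$. Fix $m\ge 1$. Let $X^1=(X^1_n)_{n\ge0}$ and $X^2=(X^2_n)_{n\ge0}$ be two such chains (possibly on different probability spaces) with initial laws $\mu^1$ and $\mu^2$. Put $$\Lambda_{t,x,x'}:=\tfrac12\big(P_{t,x}(t+m,\cdot)+P_{t,x'}(t+m,\cdot)\big),\qquad p_t(x,u):=\frac{P_{t,x}(t+m,du)}{\Lambda_{t,x,x'}(du)},\qquad p_t(x',u):=\frac{P_{t,x'}(t+m,du)}{\Lambda_{t,x,x'}(du)},$$ $$\alpha^{(m)}_t(x,x'):=\int\Big(\frac{P_{t,x'}(t+m,dy)}{P_{t,x}(t+m,dy)}\wedge 1\Big)P_{t,x}(t+m,dy),\qquad \alpha(0):=\int\Big(\frac{\mu^1(dy)}{\mu^2(dy)}\wedge 1\Big)\mu^2(dy),$$ where ratios of measures are densities of absolutely continuous parts. Assume that for each $t$ the density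 of $P_{t,x}(t+m,\cdot)$ with respect to $\Lambda_{t,x,x'}$ has a version that is jointly measurable in $(x,x',u)$ (automatic if $\mathcal S$ is countably generated). \textbf{Construction.} Let $(\eta^1_{nm},\eta^2_{nm},\xi_{nm},\zeta_{nm})_{n\ge 0}$ be a Markov process on $S\times S\times S\times\{0,1\}$ with the following initial law and transition probabilities. \emph{Initial law.} Let $\Lambda_0=(\mu^1+\mu^2)/2$ and $q^i=d\mu^i/d\Lambda_0$. If $0<\alpha(0)<1$, the four variables at time $0$ are independent, $\eta^i_0$ has density $(q^i-q^1\wedge q^2)/(1-\alpha(0))$ and $\xi_0$ has density $(q^1\wedge q^2)/\alpha(0)$ with respect to $\Lambda_0$, and $\mathsf P(\zeta_0=0)=\alpha(0)=1-\mathsf P(\zeta_0=1)$. If $\alpha(0)=0$, then $\eta^1_0\sim\mu^1$ and $\eta^2_0\sim\mu^2$ are independent, $\xi_0=\eta^1_0$ and $\zeta_0=1$. If $\alpha(0)=1$, then $\eta^1_0=\eta^2_0=\xi_0\sim\mu^1$ and $\zeta_0=0$. \emph{Transition from time $t=nm$ to $t+m$.} Given the values $(x^1,x^2,x^3,x^4)$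 at time $t$, the four new values are independent. Write $\alpha=\alpha^{(m)}_t(x^1,x^2)$ and $\Lambda=\Lambda_{t,x^1,x^2}$. For $i=1,2$ the new $\eta^i$ has density $\dfrac{p_t(x^i,u)-p_t(x^1,u)\wedge p_t(x^2,u)}{1-\alpha}$ with respect to $\Lambda$ if $\alpha<1$, and law $P_{t,x^1}(t+m,\cdot)=P_{t,x^2}(t+m,\cdot)$ if $\alpha=1$. The new $\xi$ has density $\dfrac{p_t(x^1,u)\wedge p_t(x^2,u)}{\alpha}$ with respect to $\Lambda$ if $x^4=1$ and $\alpha>0$, and law $P_{t,x^3}(t+m,\cdot)$ if $x^4=0$ or $\alpha=0$. The new $\zeta$ is $0$ with probability $\alpha$ and $1$ with probability $1-\alpha$ if $x^4=1$, and it is $0$ if $x^4=0$. For $n\ge 0$ and $i=1,2$ put $\widetilde X^i_{nm}:=\eta^i_{nm}$ if $\zeta_{nm}=1$ and $\widetilde X^i_{nm}:=\xi_{nm}$ if $\zeta_{nm}=0$. \textbf{Claim.} Such a four-component process exists, and every such process has the following properties. 1. $\widetilde X^i_{nm}\stackrel d=X^i_{nm}$ for all $n\ge0$, and $(\widetilde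 X^i_{nm})_{n\ge0}\stackrel d=(X^i_{nm})_{n\ge0}$ as random trajectories, $i=1,2$; in particular each $(\widetilde X^i_{nm})_{n\ge 0}$ is a Markov process with the transition probabilities $P_{nm,x}((n+1)m,\cdot)$ of $(X^i_{nm})_{n\ge0}$. 2. The pair $(\widetilde X^1_{nm},\widetilde X^2_{nm})_{n\ge0}$ is a non-homogeneous Markov process. With $t=nm$, its transition probability from time $t$ to time $t+m$, started at $(x,x')$, is the probability measure $$1(x\ne x')\Big[\frac{\big(p_t(x,u)-p_t(x,u)\wedge p_t(x',u)\big)\big(p_t(x',v)-p_t(x,v)\wedge p_t(x',v)\big)}{1-\alpha_t^{(m)}(x,x')}\,\Lambda_{t,x,x'}(du)\,\Lambda_{t,x,x'}(dv)+\big(p_t(x,u)\wedge p_t(x',u)\big)\Lambda_{t,x,x'}(du)\,\delta_u(dv)\Big]$$ $$+\;1(x=x')\,P_{t,x}(t+m,du)\,\delta_u(dv),$$ where the first summand is read as $0$ if $\alpha_t^{(m)}(x,x')=1$. 3. Almost surely, $\widetilde X^1_{nm}=\widetilde X^2_{nm}$ for all $n\ge n_0:=\inf\{k\ge0:\zeta_{km}=0\}$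 ($\inf\emptyset=\infty$). 4. For every $n\ge 0$, $$\mathsf P\big(\widetilde X^1_{nm}\ne\widetilde X^2_{nm}\big)\le\mathsf E\prod_{i=0}^{n-1}\Big(1-\alpha^{(m)}_{im}(\eta^1_{im},\eta^2_{im})\Big)$$ (the left side is an outer probability if the diagonal of $S\times S$ is not measurable). -/

import Mathlib

open MeasureTheory ProbabilityTheory
open scoped ENNReal

universe u v₁ v₂ w

namespace MarkovCoupling

noncomputable section

/-! ### Two probability measures -/

section TwoMeasures

variable {S : Type*} [MeasurableSpace S]

/-- The overlap `∫ (dν/dμ ∧ 1) dμ`, where `dν/dμ` is the density of the absolutely continuous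
part of `ν` with respect to `μ`. -/
def overlap (μ ν : Measure S) : ℝ≥0∞ := ∫⁻ y, min (ν.rnDeriv μ y) 1 ∂μ

/-- The reference measure `Λ = (μ + ν) / 2`. -/
def refMeasure (μ ν : Measure S) : Measure S := (2⁻¹ : ℝ≥0∞) • (μ + ν)

/-- The minimum `p ∧ q` of the densities `p`, `q` of `μ`, `ν` with respect to `Λ`. -/
def minDensity (μ ν : Measure S) (u : S) : ℝ≥0∞ :=
  min (μ.rnDeriv (refMeasure μ ν) u) (ν.rnDeriv (refMeasure μ ν) u)

/-- The function `p - p ∧ q`. -/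
def excessDensity (μ ν : Measure S) (u : S) : ℝ≥0∞ :=
  μ.rnDeriv (refMeasure μ ν) u - minDensity μ ν u

open scoped Classical in
/-- The law with density `(p - p ∧ q) / (1 - α)` with respect to `Λ`, where `α` is the overlap;
if `α = 1` (which means `μ = ν`) it is `μ`. -/
def excessLaw (μ ν : Measure S) : Measure S :=
  if overlap μ ν = 1 then μ
  else (refMeasure μ ν).withDensity fun u => excessDensity μ ν u / (1 - overlap μ ν)

/-- The law with density `(p ∧ q) / α` with respect to `Λ` (used only for `α ≠ 0`). -/
def commonLaw (μ ν : Measure S) : Measure S :=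
  (refMeasure μ ν).withDensity fun u => minDensity μ ν u / overlap μ ν

/-- The law on `{0, 1}` that gives mass `a` to `0` and mass `1 - a` to `1`. -/
def bernoulliLaw (a : ℝ≥0∞) : Measure (Fin 2) :=
  a • Measure.dirac 0 + (1 - a) • Measure.dirac 1

end TwoMeasures

/-! ### Markov processes in discrete time -/

/-- `Y` is a (non-homogeneous) Markov process under `Pr`, with respect to its own filtration, with
transition probabilities `κ n y` from time `n` to time `n + 1`:
`Pr(Y (n+1) ∈ B | Y 0, …, Y n) = κ n (Y n) B` almost surely, for all `n` and measurable `B`. -/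
structure IsMarkovProcess {E Ω : Type*} [MeasurableSpace E] [MeasurableSpace Ω]
    (κ : ℕ → E → Measure E) (Y : ℕ → Ω → E) (Pr : Measure Ω) : Prop where
  measurable : ∀ n, Measurable (Y n)
  markov : ∀ (n : ℕ) (B : Set E), MeasurableSet B →
    Pr⟦Y (n + 1) ⁻¹' B | ⨆ k ∈ Set.Iic n, MeasurableSpace.comap (Y k) inferInstance⟧
      =ᵐ[Pr] fun ω => (κ n (Y n ω)).real B

section Chain

variable {S : Type*} [MeasurableSpace S]

/-- `transition P t k x = P_{t,x}(t + k, ·)`, where `P t` is the one-step transition kernel from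
time `t` to time `t + 1`. -/
def transition (P : ℕ → Kernel S S) (t : ℕ) : ℕ → Kernel S S
  | 0 => Kernel.id
  | k + 1 => P (t + k) ∘ₖ transition P t k

/-- `α_t^{(m)}(x, x') = ∫ (P_{t,x'}(t+m,dy) / P_{t,x}(t+m,dy) ∧ 1) P_{t,x}(t+m,dy)`. -/
def alpha (P : ℕ → Kernel S S) (m t : ℕ) (x x' : S) : ℝ≥0∞ :=
  overlap (transition P t m x) (transition P t m x')

/-- The `m`-step densities of `P_{t,x}(t+m, ·)` with respect to
`Λ_{x,x'} = (P_{t,x}(t+m, ·) + P_{t,x'}(t+m, ·)) / 2` have versions that are jointly measurable in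
`(x, x', u)`. -/
def HasMeasurableDensities (P : ℕ → Kernel S S) (m : ℕ) : Prop :=
  ∀ t : ℕ, ∃ g : S × S → S → ℝ≥0∞, Measurable (Function.uncurry g) ∧
    ∀ x x' : S,
      g (x, x') =ᵐ[refMeasure (transition P t m x) (transition P t m x')]
        (transition P t m x).rnDeriv (refMeasure (transition P t m x) (transition P t m x'))

open scoped Classical in
/-- The joint law of `(η¹_0, η²_0, ξ_0, ζ_0)`, with
`α(0) = ∫ (μ¹(dy) / μ²(dy) ∧ 1) μ²(dy)`. For `0 < α(0) < 1` the four variables are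
independent. -/
def couplingInit (μ₁ μ₂ : Measure S) : Measure (S × S × S × Fin 2) :=
  if overlap μ₂ μ₁ = 1 then μ₁.map fun x => (x, x, x, 0)
  else if overlap μ₂ μ₁ = 0 then (μ₁.prod μ₂).map fun z => (z.1, z.2, z.1, 1)
  else (excessLaw μ₁ μ₂).prod ((excessLaw μ₂ μ₁).prod
    ((commonLaw μ₁ μ₂).prod (bernoulliLaw (overlap μ₂ μ₁))))

open scoped Classical in
/-- The transition probability of `(η¹, η², ξ, ζ)` from time `t` to time `t + m`: given
`x = (x¹, x², x³, x⁴)` the four new values are independent, with the laws `φ₁`, `φ₂`, `φ₃`, `φ₄`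
below; `x⁴ = 0` means that the coupling has already taken place. -/
def couplingStep (P : ℕ → Kernel S S) (m t : ℕ) (x : S × S × S × Fin 2) :
    Measure (S × S × S × Fin 2) :=
  let Q₁ := transition P t m x.1
  let Q₂ := transition P t m x.2.1
  let Q₃ := transition P t m x.2.2.1
  let a := alpha P m t x.1 x.2.1
  let φ₁ : Measure S := excessLaw Q₁ Q₂
  let φ₂ : Measure S := excessLaw Q₂ Q₁
  let φ₃ : Measure S := if x.2.2.2 = 1 ∧ a ≠ 0 then commonLaw Q₁ Q₂ else Q₃
  let φ₄ : Measure (Fin 2) := if x.2.2.2 = 1 then bernoulliLaw a else Measure.dirac 0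
  φ₁.prod (φ₂.prod (φ₃.prod φ₄))

/-- `(η¹, η², ξ, ζ) ↦ η¹ 1(ζ = 1) + ξ 1(ζ = 0)`. -/
def comp₁ (y : S × S × S × Fin 2) : S := if y.2.2.2 = 1 then y.1 else y.2.2.1

/-- `(η¹, η², ξ, ζ) ↦ η² 1(ζ = 1) + ξ 1(ζ = 0)`. -/
def comp₂ (y : S × S × S × Fin 2) : S := if y.2.2.2 = 1 then y.2.1 else y.2.2.1

open scoped Classical in
/-- The transition probability of the pair `(X̃¹, X̃²)` from time `t` to time `t + m`, started at
`(x, x')`. With `p`, `q` the densities of `P_{t,x}(t+m, ·)`, `P_{t,x'}(t+m, ·)` with respect to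
`Λ = Λ_{x,x'}`, for `x ≠ x'` it is the sum of the measure with the density
`(p - p ∧ q)(u) (q - p ∧ q)(v) / (1 - α_t^{(m)}(x,x'))` with respect to `Λ(du) Λ(dv)` and of the
measure on the diagonal with the density `(p ∧ q)(u)` with respect to `Λ(du)`;
for `x = x'` it is `P_{t,x}(t+m, ·)` on the diagonal. -/
def pairStep (P : ℕ → Kernel S S) (m t : ℕ) (z : S × S) : Measure (S × S) :=
  let Q := transition P t m z.1
  let Q' := transition P t m z.2
  if z.1 = z.2 then Q.map fun u => (u, u)
  else ((refMeasure Q Q').prod (refMeasure Q Q')).withDensity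
      (fun w => excessDensity Q Q' w.1 * excessDensity Q' Q w.2 / (1 - alpha P m t z.1 z.2))
    + ((refMeasure Q Q').withDensity (minDensity Q Q')).map fun u => (u, u)

/-- The index `n₀ = inf {k ≥ 0 : ζ_{km} = 0}` of the coupling time (`∞` if there is no such `k`),
where `Y k` is the value of `(η¹, η², ξ, ζ)` at time `k m`. -/
def couplingIndex {Ω : Type*} (Y : ℕ → Ω → S × S × S × Fin 2) (ω : Ω) : ℕ∞ :=
  ⨅ (k : ℕ) (_ : (Y k ω).2.2.2 = 0), (k : ℕ∞)

end Chain

end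

end MarkovCoupling

/-! Two probability measures with densities p and q split as p = (p - p ∧ q) + p ∧ q, and likewise
for q. Draw both coordinates equal from the common part with probability α, its total mass, and
independently from the normalised excesses otherwise: the marginals are the given measures
(`pairLaw`, `fst_pairLaw`, `snd_pairLaw`).

The pair selected from (η¹, η², ξ) by ζ makes exactly such a draw at each step. If the current ζ is
1, the new ζ decides between excesses and common part; if it is 0, the pair sits on the diagonal and
both coordinates follow ξ. In either case the law of the new pair depends on the four-component
state only through the current pair (`map_compPair_couplingStep`), so the pair is Markov by
`IsMarkovProcess.comp`, and projecting once more gives each component. The initial law and the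
transition kernels determine the law of the trajectory (`IsMarkovProcess.identDistrib`). Existence
is the Ionescu-Tulcea theorem, once `couplingStep` is known to be measurable in the state; this is
where the jointly measurable densities enter.

The state ζ = 0 is absorbing and forces the components to agree, so disagreement at time n lies in
{ζ = 1}. From ζ = 1 a step leaves ζ = 1 with probability 1 - α, independently of the new η's, whose
law does not involve ξ or ζ. Removing one step at a time produces the product in the bound
(`lintegral_uncoupled_le`). -/

namespace MarkovCoupling

/-! ### Markov processes through restricted laws: images, subsampling, uniqueness, existence. -/

section Markov

variable {E F Ω Ω' : Type*} [MeasurableSpace E] [MeasurableSpace F]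

/-- The σ-algebra generated by `Y 0, …, Y n`. -/
abbrev past (Y : ℕ → Ω → E) (n : ℕ) : MeasurableSpace Ω :=
  ⨆ k ∈ Set.Iic n, MeasurableSpace.comap (Y k) inferInstance

lemma comap_le_past (Y : ℕ → Ω → E) {k n : ℕ} (h : k ≤ n) :
    MeasurableSpace.comap (Y k) inferInstance ≤ past Y n :=
  le_iSup₂_of_le k h le_rfl

lemma measurable_past (Y : ℕ → Ω → E) {k n : ℕ} (h : k ≤ n) : Measurable[past Y n] (Y k) :=
  Measurable.of_comap_le (comap_le_past Y h)

lemma past_mono (Y : ℕ → Ω → E) {k n : ℕ} (h : k ≤ n) : past Y k ≤ past Y n :=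
  iSup₂_le fun _ hj => comap_le_past Y (le_trans hj h)

lemma past_comp_le (Y : ℕ → Ω → E) {f : E → F} (hf : Measurable f) (n : ℕ) :
    past (fun k ω => f (Y k ω)) n ≤ past Y n :=
  iSup₂_le fun _ hk => (hf.comp (measurable_past Y hk)).comap_le

lemma past_subsample_le (Y : ℕ → Ω → E) (m n : ℕ) :
    past (fun k => Y (k * m)) n ≤ past Y (n * m) :=
  iSup₂_le fun _ hk => comap_le_past Y (Nat.mul_le_mul_right m hk)

lemma measurableSet_past_forall_le (Y : ℕ → Ω → E) {B : ℕ → Set E} (hB : ∀ i, MeasurableSet (B i))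
    (n : ℕ) : MeasurableSet[past Y n] {ω | ∀ i ≤ n, Y i ω ∈ B i} := by
  have : {ω | ∀ i ≤ n, Y i ω ∈ B i} = ⋂ i ∈ Set.Iic n, Y i ⁻¹' B i := by ext; simp
  rw [this]
  exact MeasurableSet.biInter (m := past Y n) (Set.to_countable _)
    fun i hi => measurable_past Y hi (hB i)

lemma setOf_forall_le_succ {α β : Type*} (Y : ℕ → α → β) (B : ℕ → Set β) (n : ℕ) :
    {ω | ∀ i ≤ n + 1, Y i ω ∈ B i} = {ω | ∀ i ≤ n, Y i ω ∈ B i} ∩ Y (n + 1) ⁻¹' B (n + 1) := by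
  ext ω
  simp only [Nat.le_succ_iff_eq_or_le, Set.mem_ofPred_eq, Set.mem_inter_iff, Set.mem_preimage]
  grind

lemma preimage_pi_eq_setOf_forall_le {α β : Type*} (Y : ℕ → α → β) (s : Finset ℕ) (t : ℕ → Set β)
    [DecidablePred (· ∈ s)] :
    (fun ω n => Y n ω) ⁻¹' (s : Set ℕ).pi t =
      {ω | ∀ i ≤ s.sup id, Y i ω ∈ if i ∈ s then t i else Set.univ} := by
  ext ω
  simp only [Set.mem_preimage, Set.mem_pi, Finset.mem_coe, Set.mem_ofPred_eq]
  constructor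
  · intro h i _
    by_cases hi : i ∈ s <;> simp [hi, h]
  · intro h i hi
    simpa [hi] using h i (Finset.le_sup (f := id) hi)

variable [MeasurableSpace Ω] [MeasurableSpace Ω']

lemma past_le {Y : ℕ → Ω → E} (hY : ∀ n, Measurable (Y n)) (n : ℕ) :
    past Y n ≤ ‹MeasurableSpace Ω› :=
  iSup₂_le fun k _ => (hY k).comap_le

/-- Integrating the conditional probability over past events turns the Markov property into an
identity of finite measures. Images, compositions and inductions then need no conditional
expectations. -/
theorem isMarkovProcess_iff (κ : ℕ → Kernel E E) [∀ n, IsMarkovKernel (κ n)] (Y : ℕ → Ω → E)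
    (Pr : Measure Ω) [IsProbabilityMeasure Pr] :
    IsMarkovProcess (fun n x => κ n x) Y Pr ↔ (∀ n, Measurable (Y n)) ∧
      ∀ n A, MeasurableSet[past Y n] A →
        (Pr.restrict A).map (Y (n + 1)) = κ n ∘ₘ (Pr.restrict A).map (Y n) := by
  have key (hY : ∀ n, Measurable (Y n)) (n : ℕ) (A : Set Ω) (B : Set E) (hB : MeasurableSet B) :
      ((Pr.restrict A).map (Y (n + 1)) B = Pr.restrict A (Y (n + 1) ⁻¹' B)) ∧
      ((κ n ∘ₘ (Pr.restrict A).map (Y n)) B = ENNReal.ofReal (∫ ω in A, (κ n (Y n ω)).real B ∂Pr))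
      := by
    refine ⟨Measure.map_apply (hY _) hB, ?_⟩
    have hm := (κ n).measurable_coe hB
    rw [Measure.bind_apply hB (κ n).aemeasurable, lintegral_map hm (hY n)]
    simp only [measureReal_def]
    rw [integral_toReal (f := fun ω => κ n (Y n ω) B) (hm.comp (hY n)).aemeasurable (by simp),
      ENNReal.ofReal_toReal]
    refine ((lintegral_mono (g := fun _ => 1) fun ω => prob_le_one).trans_lt ?_).ne
    simp
  have hint (hY : ∀ n, Measurable (Y n)) (n : ℕ) (A : Set Ω) (B : Set E) (hB : MeasurableSet B) :
      ∫ ω in A, (Y (n + 1) ⁻¹' B).indicator (fun _ => (1 : ℝ)) ω ∂Pr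
        = (Pr.restrict A).real (Y (n + 1) ⁻¹' B) := by
    rw [integral_indicator_const _ (hY _ hB), smul_eq_mul, mul_one]
  have hbd (hY : ∀ n, Measurable (Y n)) (n : ℕ) (B : Set E) (hB : MeasurableSet B) :
      Integrable (fun ω => (κ n (Y n ω)).real B) Pr :=
    Integrable.of_bound (((κ n).measurable_coe hB).comp (hY n)).ennreal_toReal.aestronglyMeasurable
      1 (by simp [abs_of_nonneg, measureReal_le_one])
  constructor
  · rintro ⟨hY, hM⟩
    refine ⟨hY, fun n A hA => Measure.ext fun B hB => ?_⟩
    rw [(key hY n A B hB).1, (key hY n A B hB).2,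
      ← integral_congr_ae (ae_restrict_of_ae (hM n B hB)),
      setIntegral_condExp (past_le hY n) ((integrable_const _).indicator (hY _ hB)) hA,
      hint hY n A B hB, ofReal_measureReal]
  · rintro ⟨hY, hM⟩
    refine ⟨hY, fun n B hB => ?_⟩
    refine (ae_eq_condExp_of_forall_setIntegral_eq (past_le hY n)
      ((integrable_const _).indicator (hY _ hB)) (fun _ _ _ => (hbd hY n B hB).integrableOn)
      (fun A hA _ => ?_) ?_).symm
    · rw [hint hY n A B hB, measureReal_def, ← (key hY n A B hB).1, hM n A hA,
        (key hY n A B hB).2, ENNReal.toReal_ofReal (integral_nonneg fun _ => measureReal_nonneg)]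
    · exact (((κ n).measurable_coe hB).comp
        (measurable_past Y le_rfl)).ennreal_toReal.aestronglyMeasurable

variable {Pr : Measure Ω} [IsProbabilityMeasure Pr] {Pr' : Measure Ω'} [IsProbabilityMeasure Pr']

/-- Indicators of past events are handled by the restricted-law identity; sums and monotone limits
extend it to all past-measurable weights. -/
theorem IsMarkovProcess.lintegral_mul {κ : ℕ → Kernel E E} [∀ n, IsMarkovKernel (κ n)]
    {Y : ℕ → Ω → E} (hY : IsMarkovProcess (fun n x => κ n x) Y Pr) (n : ℕ)
    {g : Ω → ℝ≥0∞} (hg : Measurable[past Y n] g) {h : E → ℝ≥0∞} (hh : Measurable h) :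
    ∫⁻ ω, g ω * h (Y (n + 1) ω) ∂Pr = ∫⁻ ω, g ω * ∫⁻ y, h y ∂κ n (Y n ω) ∂Pr := by
  obtain ⟨hm, hM⟩ := (isMarkovProcess_iff κ Y Pr).1 hY
  have hle := past_le hm n
  have hh1 : Measurable fun ω => h (Y (n + 1) ω) := hh.comp (hm _)
  have hh2 : Measurable fun ω => ∫⁻ y, h y ∂κ n (Y n ω) := (hh.lintegral_kernel).comp (hm _)
  have hmul {f k : Ω → ℝ≥0∞} (hf : Measurable[past Y n] f) (hk : Measurable k) :
      Measurable fun ω => f ω * k ω := (hf.mono hle le_rfl).mul hk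
  refine Measurable.ennreal_induction (mα := past Y n) (motive := fun g =>
    ∫⁻ ω, g ω * h (Y (n + 1) ω) ∂Pr = ∫⁻ ω, g ω * ∫⁻ y, h y ∂κ n (Y n ω) ∂Pr)
    (fun c A hA => ?_) (fun f g _ hf hg ihf ihg => ?_) (fun f hf hmono ih => ?_) hg
  · have h1 : ∀ k : Ω → ℝ≥0∞, Measurable k → ∫⁻ ω, A.indicator (fun _ => c) ω * k ω ∂Pr
        = c * ∫⁻ ω in A, k ω ∂Pr := fun k hk => by
      rw [← lintegral_const_mul _ hk, ← lintegral_indicator (hle _ hA)]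
      congr with ω
      by_cases hω : ω ∈ A <;> simp [hω]
    rw [h1 _ hh1, h1 _ hh2, ← lintegral_map hh (hm _), hM n A hA,
      Measure.lintegral_bind (κ n).aemeasurable hh.aemeasurable,
      lintegral_map hh.lintegral_kernel (hm n)]
  · simp only [Pi.add_apply, add_mul]
    rw [lintegral_add_left (hmul hf hh1),
      lintegral_add_left (hmul hf hh2), ihf, ihg]
  · simp only [ENNReal.iSup_mul]
    rw [lintegral_iSup (fun k => hmul (hf k) hh1)
        (fun i j hij ω => mul_le_mul_left (hmono hij ω) _),
      lintegral_iSup (fun k => hmul (hf k) hh2)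
        (fun i j hij ω => mul_le_mul_left (hmono hij ω) _)]
    simp only [ih]

/-- A function of a Markov process is a Markov process if the images of the transition
probabilities factor through the function. -/
theorem IsMarkovProcess.comp {κ : ℕ → Kernel E E} [∀ n, IsMarkovKernel (κ n)]
    {κ' : ℕ → Kernel F F} [∀ n, IsMarkovKernel (κ' n)]
    {Y : ℕ → Ω → E} (hY : IsMarkovProcess (fun n x => κ n x) Y Pr)
    {f : E → F} (hf : Measurable f) (h : ∀ n x, (κ n x).map f = κ' n (f x)) :
    IsMarkovProcess (fun n x => κ' n x) (fun n ω => f (Y n ω)) Pr := by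
  obtain ⟨hm, hM⟩ := (isMarkovProcess_iff κ Y Pr).1 hY
  refine (isMarkovProcess_iff κ' _ Pr).2 ⟨fun n => hf.comp (hm n), fun n A hA => ?_⟩
  have hmap (k : ℕ) : (Pr.restrict A).map (fun ω => f (Y k ω)) =
      ((Pr.restrict A).map (Y k)).map f := (Measure.map_map hf (hm k)).symm
  have hker : (κ n).map f = (κ' n).comap f hf := by
    ext1 x
    rw [Kernel.map_apply _ hf, Kernel.comap_apply, h]
  rw [hmap, hmap, hM n A (past_comp_le Y hf n A hA), Measure.map_comp _ _ hf, hker]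
  ext s hs
  rw [Measure.bind_apply hs (Kernel.aemeasurable _), Measure.bind_apply hs (Kernel.aemeasurable _),
    lintegral_map ((κ' n).measurable_coe hs) hf]
  rfl

instance isMarkovKernel_transition (P : ℕ → Kernel E E) [∀ t, IsMarkovKernel (P t)] (t k : ℕ) :
    IsMarkovKernel (transition P t k) := by
  induction k with
  | zero => exact inferInstanceAs (IsMarkovKernel Kernel.id)
  | succ k ih => exact inferInstanceAs (IsMarkovKernel (P (t + k) ∘ₖ transition P t k))

/-- Chapman-Kolmogorov on a past event: an event known at time n is still in the past at time n + k,
so the one-step identity can be iterated. -/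
theorem IsMarkovProcess.map_add {P : ℕ → Kernel E E} [∀ t, IsMarkovKernel (P t)]
    {X : ℕ → Ω → E} (hX : IsMarkovProcess (fun t x => P t x) X Pr) (n k : ℕ)
    {A : Set Ω} (hA : MeasurableSet[past X n] A) :
    (Pr.restrict A).map (X (n + k)) = transition P n k ∘ₘ (Pr.restrict A).map (X n) := by
  induction k with
  | zero => exact Measure.id_comp.symm
  | succ k ih =>
    rw [← add_assoc, ((isMarkovProcess_iff P X Pr).1 hX).2 _ A (past_mono X (by lia) A hA), ih,
      Measure.comp_assoc]
    rfl

theorem IsMarkovProcess.subsample {P : ℕ → Kernel E E} [∀ t, IsMarkovKernel (P t)]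
    {X : ℕ → Ω → E} (hX : IsMarkovProcess (fun t x => P t x) X Pr) (m : ℕ) :
    IsMarkovProcess (fun n x => transition P (n * m) m x) (fun n => X (n * m)) Pr := by
  refine (isMarkovProcess_iff (fun n => transition P (n * m) m) _ Pr).2
    ⟨fun n => hX.measurable _, fun n A hA => ?_⟩
  rw [add_mul, one_mul, hX.map_add _ _ (past_subsample_le X m n A hA)]

lemma map_restrict_inter_preimage (Q : Measure Ω) {Z : Ω → E} (hZ : Measurable Z) (A : Set Ω)
    {B : Set E} (hB : MeasurableSet B) :
    (Q.restrict (A ∩ Z ⁻¹' B)).map Z = ((Q.restrict A).map Z).restrict B := by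
  rw [Measure.restrict_map hZ hB, Measure.restrict_restrict (hZ hB), Set.inter_comm]

/-- Cylinders form a generating π-system. The induction over time carries the whole law of the
current state restricted to the cylinder event, since its probability alone would not determine the
next step. -/
theorem IsMarkovProcess.identDistrib {κ : ℕ → Kernel E E} [∀ n, IsMarkovKernel (κ n)]
    {Y : ℕ → Ω → E} (hY : IsMarkovProcess (fun n x => κ n x) Y Pr)
    {Y' : ℕ → Ω' → E} (hY' : IsMarkovProcess (fun n x => κ n x) Y' Pr')
    (h0 : Pr.map (Y 0) = Pr'.map (Y' 0)) :
    IdentDistrib (fun ω n => Y n ω) (fun ω n => Y' n ω) Pr Pr' := by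
  obtain ⟨hm, hM⟩ := (isMarkovProcess_iff κ Y Pr).1 hY
  obtain ⟨hm', hM'⟩ := (isMarkovProcess_iff κ Y' Pr').1 hY'
  have hmeas : Measurable (fun ω n => Y n ω) := measurable_pi_lambda _ hm
  have hmeas' : Measurable (fun ω n => Y' n ω) := measurable_pi_lambda _ hm'
  have main (B : ℕ → Set E) (hB : ∀ i, MeasurableSet (B i)) (n : ℕ) :
      (Pr.restrict {ω | ∀ i ≤ n, Y i ω ∈ B i}).map (Y n) =
        (Pr'.restrict {ω | ∀ i ≤ n, Y' i ω ∈ B i}).map (Y' n) := by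
    induction n with
    | zero =>
      have h1 := map_restrict_inter_preimage Pr (hm 0) Set.univ (hB 0)
      have h2 := map_restrict_inter_preimage Pr' (hm' 0) Set.univ (hB 0)
      simp only [Set.univ_inter, Measure.restrict_univ] at h1 h2
      simp only [nonpos_iff_eq_zero, forall_eq]
      exact h1.trans (h0 ▸ h2.symm)
    | succ n ih =>
      rw [setOf_forall_le_succ, setOf_forall_le_succ,
        map_restrict_inter_preimage Pr (hm _) _ (hB _),
        map_restrict_inter_preimage Pr' (hm' _) _ (hB _),
        hM n _ (measurableSet_past_forall_le Y hB n),
        hM' n _ (measurableSet_past_forall_le Y' hB n), ih]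
  refine ⟨hmeas.aemeasurable, hmeas'.aemeasurable, ?_⟩
  have := Measure.isProbabilityMeasure_map (μ := Pr) hmeas.aemeasurable
  have := Measure.isProbabilityMeasure_map (μ := Pr') hmeas'.aemeasurable
  refine ext_of_generate_finite _ generateFrom_squareCylinders.symm
    (isPiSystem_squareCylinders (fun _ => MeasurableSpace.isPiSystem_measurableSet) (by simp))
    ?_ (by simp)
  rintro _ ⟨s, t, ht, rfl⟩
  have ht' : ∀ i, MeasurableSet (t i) := by simpa using ht
  classical
  -- Leaving the times outside `s` unconstrained turns the cylinder into an event on an initial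
  -- segment of times.
  set B : ℕ → Set E := fun i => if i ∈ s then t i else Set.univ
  have hB : ∀ i, MeasurableSet (B i) := fun i => by
    by_cases hi : i ∈ s <;> simp [B, hi, ht' i]
  have hms : MeasurableSet ((s : Set ℕ).pi t) :=
    MeasurableSet.pi s.countable_toSet fun i _ => ht' i
  rw [Measure.map_apply hmeas hms, Measure.map_apply hmeas' hms, preimage_pi_eq_setOf_forall_le,
    preimage_pi_eq_setOf_forall_le]
  have h1 := congrArg (fun ν => ν Set.univ) (main B hB (s.sup id))
  simpa only [Measure.map_apply (hm _) .univ, Measure.map_apply (hm' _) .univ, Set.preimage_univ,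
    Measure.restrict_apply_univ] using h1

/-- Ionescu-Tulcea on the trajectory space, with history kernels that read only the last coordinate,
mixed over the initial law. -/
theorem exists_isMarkovProcess (κ : ℕ → Kernel E E) [∀ n, IsMarkovKernel (κ n)]
    (μ : Measure E) [IsProbabilityMeasure μ] :
    ∃ Q : Measure (ℕ → E), IsProbabilityMeasure Q ∧
      IsMarkovProcess (fun n x => κ n x) (fun n ω => ω n) Q ∧ Q.map (fun ω => ω 0) = μ := by
  have hev (n : ℕ) : Measurable fun x : (Finset.Iic n) → E => x ⟨n, Finset.mem_Iic.2 le_rfl⟩ :=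
    measurable_pi_apply _
  let κ' (n : ℕ) : Kernel ((i : Finset.Iic n) → E) E := (κ n).comap _ (hev n)
  have hc : Measurable fun (x : E) (_ : Finset.Iic 0) => x := by fun_prop
  have : IsProbabilityMeasure (μ.map fun (x : E) (_ : Finset.Iic 0) => x) :=
    Measure.isProbabilityMeasure_map hc.aemeasurable
  let T : Kernel ((i : Finset.Iic 0) → E) (ℕ → E) := Kernel.traj (X := fun _ => E) κ' 0
  refine ⟨T ∘ₘ (μ.map fun (x : E) (_ : Finset.Iic 0) => x), inferInstance, ?_, ?_⟩
  · refine (isMarkovProcess_iff κ _ _).2 ⟨fun n => measurable_pi_apply n, fun n A hA => ?_⟩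
    -- Past events are preimages of sets of finite histories, the form in which `Kernel.traj`
    -- describes its next coordinate.
    have hle : past (fun n (ω : ℕ → E) => ω n) n ≤
        MeasurableSpace.comap (Preorder.frestrictLe (π := fun _ => E) n) inferInstance := by
      refine iSup₂_le fun k hk => ?_
      have : Measurable fun x : (Finset.Iic n) → E => x ⟨k, Finset.mem_Iic.2 hk⟩ :=
        measurable_pi_apply _
      exact (this.comp (comap_measurable (Preorder.frestrictLe (π := fun _ => E) n))).comap_le
    obtain ⟨A', hA', rfl⟩ := hle A hA
    have hfr := Preorder.measurable_frestrictLe (X := fun _ : ℕ => E) n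
    have hmA := hfr hA'
    -- The Markov identity is first proved for a fixed starting point and afterwards integrated
    -- against the initial law.
    have hT (x : (i : Finset.Iic 0) → E) :
        ((T x).restrict (Preorder.frestrictLe n ⁻¹' A')).map (fun ω => ω (n + 1)) =
          κ n ∘ₘ ((T x).restrict (Preorder.frestrictLe n ⁻¹' A')).map (fun ω => ω n) := by
      ext B hB
      have h1 := congrArg (fun ν => ν (A' ×ˢ B))
        (Kernel.partialTraj_compProd_eq_map_traj (X := fun _ => E) (κ := κ') (Nat.zero_le n) (x₀ := x))
      beta_reduce at h1
      rw [Measure.compProd_apply_prod hA' hB, Measure.map_apply (by fun_prop) (hA'.prod hB),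
        ← Kernel.traj_map_frestrictLe_apply, setLIntegral_map hA' ((κ' n).measurable_coe hB) hfr]
        at h1
      rw [Measure.map_apply (by fun_prop) hB, Measure.bind_apply hB (κ n).aemeasurable,
        lintegral_map ((κ n).measurable_coe hB) (by fun_prop),
        Measure.restrict_apply (measurable_pi_apply _ hB), Set.inter_comm]
      exact h1.symm
    have hrestr : ∀ (g : (ℕ → E) → E), Measurable g → ∀ B, MeasurableSet B →
        (((T ∘ₘ (μ.map fun (x : E) (_ : Finset.Iic 0) => x)).restrict
          (Preorder.frestrictLe n ⁻¹' A')).map g) B =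
        ∫⁻ x, ((T x).restrict (Preorder.frestrictLe n ⁻¹' A')).map g B
          ∂(μ.map fun (x : E) (_ : Finset.Iic 0) => x) := fun g hg B hB => by
      rw [Measure.map_apply hg hB, Measure.restrict_apply (hg hB),
        Measure.bind_apply ((hg hB).inter hmA) T.aemeasurable]
      congr with x
      rw [Measure.map_apply hg hB, Measure.restrict_apply (hg hB)]
    have hmeas := measurable_pi_apply (X := fun _ : ℕ => E) n
    have hker : (((T ∘ₘ (μ.map fun (x : E) (_ : Finset.Iic 0) => x)).restrict
          (Preorder.frestrictLe n ⁻¹' A')).map fun ω => ω n) =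
        ((T.restrict hmA).map fun ω => ω n) ∘ₘ (μ.map fun (x : E) (_ : Finset.Iic 0) => x) := by
      ext B hB
      rw [hrestr _ hmeas B hB, Measure.bind_apply hB (Kernel.aemeasurable _)]
      congr with x
      rw [Kernel.map_apply _ hmeas, Kernel.restrict_apply]
    ext B hB
    rw [hrestr _ (measurable_pi_apply _) B hB, hker, Measure.comp_assoc,
      Measure.bind_apply hB (Kernel.aemeasurable _)]
    congr with x
    rw [hT, Kernel.comp_apply, Kernel.map_apply _ hmeas, Kernel.restrict_apply]
  · have h0 : (fun ω : ℕ → E => ω 0) =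
        (fun x : Finset.Iic 0 → E => x ⟨0, Finset.mem_Iic.2 le_rfl⟩) ∘
          Preorder.frestrictLe (π := fun _ => E) 0 := rfl
    have hfr := Preorder.measurable_frestrictLe (X := fun _ : ℕ => E) 0
    rw [h0, ← Measure.map_map (hev 0) hfr, Measure.map_comp _ _ hfr]
    simp only [T]
    rw [Kernel.traj_map_frestrictLe, Kernel.partialTraj_self, Measure.id_comp,
      Measure.map_map (hev 0) hc]
    exact Measure.map_id

end Markov

/-! ### Overlap, common and excess parts, and the coupling of two probability measures. -/

section TwoMeasures

variable {S : Type*} [MeasurableSpace S]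

lemma refMeasure_comm (μ ν : Measure S) : refMeasure μ ν = refMeasure ν μ := by
  rw [refMeasure, refMeasure, add_comm]

lemma minDensity_comm (μ ν : Measure S) : minDensity μ ν = minDensity ν μ := by
  ext u
  rw [minDensity, minDensity, refMeasure_comm ν μ, min_comm]

lemma measurable_minDensity (μ ν : Measure S) : Measurable (minDensity μ ν) :=
  (Measure.measurable_rnDeriv _ _).min (Measure.measurable_rnDeriv _ _)

lemma measurable_excessDensity (μ ν : Measure S) : Measurable (excessDensity μ ν) :=
  (Measure.measurable_rnDeriv _ _).sub (measurable_minDensity μ ν)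

lemma absolutelyContinuous_refMeasure (μ ν : Measure S) : μ ≪ refMeasure μ ν :=
  (Measure.AbsolutelyContinuous.rfl.add_right ν).trans
    (Measure.absolutelyContinuous_smul (by simp))

/-- The common part `μ ∧ ν` of two measures, with density `p ∧ q`. -/
noncomputable def commonPart (μ ν : Measure S) : Measure S :=
  (refMeasure μ ν).withDensity (minDensity μ ν)

/-- The excess `μ - μ ∧ ν`, with density `p - p ∧ q`. -/
noncomputable def excessPart (μ ν : Measure S) : Measure S :=
  (refMeasure μ ν).withDensity (excessDensity μ ν)

lemma commonPart_comm (μ ν : Measure S) : commonPart μ ν = commonPart ν μ := by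
  rw [commonPart, commonPart, refMeasure_comm, minDensity_comm]

lemma isProbabilityMeasure_bernoulliLaw {a : ℝ≥0∞} (ha : a ≤ 1) :
    IsProbabilityMeasure (bernoulliLaw a) :=
  ⟨by simp [bernoulliLaw, ha]⟩

lemma bernoulliLaw_one : bernoulliLaw 1 = Measure.dirac 0 := by
  simp [bernoulliLaw]

lemma lintegral_bernoulliLaw (a : ℝ≥0∞) (f : Fin 2 → ℝ≥0∞) :
    ∫⁻ i, f i ∂bernoulliLaw a = a * f 0 + (1 - a) * f 1 := by
  simp [bernoulliLaw]

lemma commonLaw_eq_smul (μ ν : Measure S) : commonLaw μ ν = (overlap μ ν)⁻¹ • commonPart μ ν := by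
  rw [commonLaw, commonPart, ← withDensity_smul _ (measurable_minDensity μ ν)]
  congr with u
  rw [Pi.smul_apply, smul_eq_mul, ENNReal.div_eq_inv_mul]

lemma excessLaw_eq_smul (μ ν : Measure S) (h : overlap μ ν ≠ 1) :
    excessLaw μ ν = (1 - overlap μ ν)⁻¹ • excessPart μ ν := by
  rw [excessLaw, if_neg h, excessPart, ← withDensity_smul _ (measurable_excessDensity μ ν)]
  congr with u
  rw [Pi.smul_apply, smul_eq_mul, ENNReal.div_eq_inv_mul]

lemma lintegral_prod_bernoulliLaw (μ ν ρ : Measure S) [SFinite μ] [SFinite ν] [SFinite ρ]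
    {a : ℝ≥0∞} (ha : a ≤ 1)
    {f : S × S × S × Fin 2 → ℝ≥0∞} (hf : Measurable f) :
    ∫⁻ y, f y ∂μ.prod (ν.prod (ρ.prod (bernoulliLaw a))) =
      a * ∫⁻ x, ∫⁻ y, ∫⁻ z, f (x, y, z, 0) ∂ρ ∂ν ∂μ +
        (1 - a) * ∫⁻ x, ∫⁻ y, ∫⁻ z, f (x, y, z, 1) ∂ρ ∂ν ∂μ := by
  have := isProbabilityMeasure_bernoulliLaw ha
  have hf' (i : Fin 2) : Measurable fun p : (S × S) × S => f (p.1.1, p.1.2, p.2, i) := by fun_prop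
  have hf2 (i : Fin 2) : Measurable fun p : S × S => ∫⁻ z, f (p.1, p.2, z, i) ∂ρ :=
    (hf' i).lintegral_prod_right'
  have hf1 (i : Fin 2) : Measurable fun x : S => ∫⁻ y, ∫⁻ z, f (x, y, z, i) ∂ρ ∂ν :=
    (hf2 i).lintegral_prod_right'
  rw [← lintegral_const_mul _ (hf1 0), ← lintegral_const_mul _ (hf1 1),
    ← lintegral_add_left ((hf1 0).const_mul a), lintegral_prod _ hf.aemeasurable]
  congr with x
  have e2 (i : Fin 2) : Measurable fun y : S => ∫⁻ z, f (x, y, z, i) ∂ρ :=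
    (hf2 i).comp measurable_prodMk_left
  rw [← lintegral_const_mul _ (e2 0), ← lintegral_const_mul _ (e2 1),
    ← lintegral_add_left ((e2 0).const_mul a), lintegral_prod _ (by fun_prop)]
  congr with y
  have e3 (i : Fin 2) : Measurable fun z : S => f (x, y, z, i) := by fun_prop
  rw [← lintegral_const_mul _ (e3 0), ← lintegral_const_mul _ (e3 1),
    ← lintegral_add_left ((e3 0).const_mul a), lintegral_prod _ (by fun_prop)]
  congr with z
  rw [lintegral_bernoulliLaw]

/-- The pair `(X̃¹, X̃²)` read off from `(η¹, η², ξ, ζ)`. -/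
def compPair (y : S × S × S × Fin 2) : S × S := (comp₁ y, comp₂ y)

lemma measurable_comp₁ : Measurable (comp₁ (S := S)) :=
  Measurable.ite (measurableSet_eq_fun (by fun_prop) (by fun_prop)) (by fun_prop) (by fun_prop)

lemma measurable_comp₂ : Measurable (comp₂ (S := S)) :=
  Measurable.ite (measurableSet_eq_fun (by fun_prop) (by fun_prop)) (by fun_prop) (by fun_prop)

lemma measurable_compPair : Measurable (compPair (S := S)) :=
  measurable_comp₁.prodMk measurable_comp₂

variable (μ ν : Measure S) [IsProbabilityMeasure μ] [IsProbabilityMeasure ν]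

instance isProbabilityMeasure_refMeasure : IsProbabilityMeasure (refMeasure μ ν) :=
  ⟨by simp [refMeasure, ENNReal.inv_two_add_inv_two]⟩

lemma excessPart_add_commonPart : excessPart μ ν + commonPart μ ν = μ := by
  rw [excessPart, commonPart, ← withDensity_add_left (measurable_excessDensity μ ν)]
  refine Eq.trans (congrArg _ (funext fun u => ?_))
    (Measure.withDensity_rnDeriv_eq μ _ (absolutelyContinuous_refMeasure μ ν))
  exact tsub_add_cancel_of_le (show minDensity μ ν u ≤ _ from min_le_left _ _)

/-- The density of ν with respect to μ is q / p up to μ-null sets, and p · (q / p ∧ 1) = p ∧ q. This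
identifies the asymmetric definition of the overlap with a symmetric quantity. -/
lemma overlap_eq_commonPart : overlap μ ν = commonPart μ ν Set.univ := by
  have hμ := absolutelyContinuous_refMeasure μ ν
  have hν : ν ≪ refMeasure μ ν := refMeasure_comm ν μ ▸ absolutelyContinuous_refMeasure ν μ
  have h1 : overlap μ ν = ∫⁻ y, min (ν.rnDeriv (refMeasure μ ν) y / μ.rnDeriv (refMeasure μ ν) y) 1
      ∂μ := by
    refine lintegral_congr_ae ?_
    filter_upwards [Measure.rnDeriv_eq_div hν hμ] with y hy
    rw [hy]
  rw [h1, ← lintegral_rnDeriv_mul hμ (by fun_prop), commonPart, withDensity_apply _ .univ,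
    Measure.restrict_univ]
  refine lintegral_congr_ae ?_
  -- Cancelling p needs 0 < p < ∞; finiteness holds almost everywhere, and where p = 0 both sides
  -- vanish.
  filter_upwards [Measure.rnDeriv_lt_top μ (refMeasure μ ν)] with y hy
  rw [minDensity]
  rcases eq_or_ne (μ.rnDeriv (refMeasure μ ν) y) 0 with h0 | h0
  · simp [h0]
  · rw [mul_min, mul_one, ENNReal.mul_div_cancel h0 hy.ne, min_comm]

lemma overlap_comm : overlap μ ν = overlap ν μ := by
  rw [overlap_eq_commonPart, overlap_eq_commonPart, commonPart_comm]

lemma overlap_add_excessPart : excessPart μ ν Set.univ + overlap μ ν = 1 := by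
  rw [overlap_eq_commonPart, ← Measure.add_apply, excessPart_add_commonPart, measure_univ]

lemma overlap_le_one : overlap μ ν ≤ 1 :=
  overlap_add_excessPart μ ν ▸ le_add_self

lemma excessPart_univ : excessPart μ ν Set.univ = 1 - overlap μ ν :=
  ENNReal.eq_sub_of_add_eq (ne_top_of_le_ne_top ENNReal.one_ne_top (overlap_le_one μ ν))
    (overlap_add_excessPart μ ν)

lemma excessPart_eq_zero (h : overlap μ ν = 1) : excessPart μ ν = 0 := by
  rw [← Measure.measure_univ_eq_zero, excessPart_univ, h, tsub_self]

lemma commonPart_eq_zero (h : overlap μ ν = 0) : commonPart μ ν = 0 := by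
  rw [← Measure.measure_univ_eq_zero, ← overlap_eq_commonPart, h]

lemma commonPart_eq_left (h : overlap μ ν = 1) : commonPart μ ν = μ := by
  simpa [excessPart_eq_zero μ ν h] using excessPart_add_commonPart μ ν

lemma eq_of_overlap_eq_one (h : overlap μ ν = 1) : μ = ν := by
  rw [← commonPart_eq_left μ ν h, commonPart_comm,
    commonPart_eq_left ν μ (overlap_comm ν μ ▸ h)]

lemma overlap_self : overlap μ μ = 1 := by
  have h := Measure.rnDeriv_self μ
  rw [overlap, lintegral_congr_ae (g := fun _ => 1) (by filter_upwards [h] with y hy; simp [hy])]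
  simp

/-- In this multiplied form the normalisation is correct even at overlap 0, where the common part
vanishes. `one_sub_overlap_smul_excessLaw` plays the same role at overlap 1. -/
lemma overlap_smul_commonLaw : overlap μ ν • commonLaw μ ν = commonPart μ ν := by
  rcases eq_or_ne (overlap μ ν) 0 with h | h
  · rw [h, zero_smul, commonPart_eq_zero μ ν h]
  · rw [commonLaw_eq_smul, smul_smul, ENNReal.mul_inv_cancel h
      (ne_top_of_le_ne_top ENNReal.one_ne_top (overlap_le_one μ ν)), one_smul]

lemma isProbabilityMeasure_commonLaw (h : overlap μ ν ≠ 0) :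
    IsProbabilityMeasure (commonLaw μ ν) :=
  ⟨by rw [commonLaw_eq_smul, Measure.smul_apply, ← overlap_eq_commonPart, smul_eq_mul,
    ENNReal.inv_mul_cancel h (ne_top_of_le_ne_top ENNReal.one_ne_top (overlap_le_one μ ν))]⟩

lemma one_sub_overlap_ne_zero (h : overlap μ ν ≠ 1) : 1 - overlap μ ν ≠ 0 :=
  (tsub_pos_of_lt (lt_of_le_of_ne (overlap_le_one μ ν) h)).ne'

lemma one_sub_overlap_smul_excessLaw :
    (1 - overlap μ ν) • excessLaw μ ν = excessPart μ ν := by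
  rcases eq_or_ne (overlap μ ν) 1 with h | h
  · rw [h, tsub_self, zero_smul, excessPart_eq_zero μ ν h]
  · rw [excessLaw_eq_smul μ ν h, smul_smul,
      ENNReal.mul_inv_cancel (one_sub_overlap_ne_zero μ ν h) (by simp), one_smul]

instance isProbabilityMeasure_excessLaw : IsProbabilityMeasure (excessLaw μ ν) := by
  rcases eq_or_ne (overlap μ ν) 1 with h | h
  · rw [excessLaw, if_pos h]
    infer_instance
  · exact ⟨by rw [excessLaw_eq_smul μ ν h, Measure.smul_apply, excessPart_univ, smul_eq_mul,
      ENNReal.inv_mul_cancel (one_sub_overlap_ne_zero μ ν h) (by simp)]⟩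

lemma excessLaw_of_overlap_eq_zero (h : overlap μ ν = 0) : excessLaw μ ν = μ := by
  have h1 := excessPart_add_commonPart μ ν
  rwa [commonPart_eq_zero μ ν h, ← one_sub_overlap_smul_excessLaw, h, tsub_zero, one_smul,
    add_zero] at h1

/-- The maximal coupling of `μ` and `ν` whose off-diagonal part has independent coordinates. -/
noncomputable def pairLaw : Measure (S × S) :=
  (1 - overlap μ ν) • (excessLaw μ ν).prod (excessLaw ν μ) +
    (commonPart μ ν).map fun u => (u, u)

lemma measurable_diag : Measurable fun u : S => (u, u) := by fun_prop

lemma fst_pairLaw : (pairLaw μ ν).map Prod.fst = μ := by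
  rw [pairLaw, Measure.map_add _ _ measurable_fst, Measure.map_smul, Measure.map_fst_prod,
    Measure.map_map measurable_fst measurable_diag, measure_univ, one_smul,
    one_sub_overlap_smul_excessLaw]
  exact (congrArg _ Measure.map_id).trans (excessPart_add_commonPart μ ν)

lemma snd_pairLaw : (pairLaw μ ν).map Prod.snd = ν := by
  rw [pairLaw, Measure.map_add _ _ measurable_snd, Measure.map_smul, Measure.map_snd_prod,
    Measure.map_map measurable_snd measurable_diag, measure_univ, one_smul, overlap_comm,
    one_sub_overlap_smul_excessLaw, commonPart_comm]
  exact (congrArg _ Measure.map_id).trans (excessPart_add_commonPart ν μ)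

instance isProbabilityMeasure_pairLaw : IsProbabilityMeasure (pairLaw μ ν) :=
  ⟨by
    have h := congrArg (fun ρ => ρ Set.univ) (fst_pairLaw μ ν)
    simpa [Measure.map_apply measurable_fst] using h⟩

lemma pairLaw_self : pairLaw μ μ = μ.map fun u => (u, u) := by
  rw [pairLaw, overlap_self, tsub_self, zero_smul, zero_add,
    commonPart_eq_left μ μ (overlap_self μ)]

lemma withDensity_excess_mul_excess :
    ((refMeasure μ ν).prod (refMeasure μ ν)).withDensity
        (fun w => excessDensity μ ν w.1 * excessDensity ν μ w.2 / (1 - overlap μ ν)) =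
      (1 - overlap μ ν) • (excessLaw μ ν).prod (excessLaw ν μ) := by
  have hm1 := measurable_excessDensity μ ν
  have hm2 := measurable_excessDensity ν μ
  rcases eq_or_ne (overlap μ ν) 1 with h | h
  · have h0 : excessDensity μ ν =ᵐ[refMeasure μ ν] 0 :=
      (withDensity_eq_zero_iff hm1.aemeasurable).1 (excessPart_eq_zero μ ν h)
    rw [h, tsub_self, zero_smul]
    -- The divisor is 0 here, but the excess density vanishes almost everywhere and 0 / 0 = 0 in
    -- `ℝ≥0∞`; this realises the convention that the first summand is read as 0.
    refine (withDensity_congr_ae ?_).trans withDensity_zero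
    filter_upwards [Measure.quasiMeasurePreserving_fst.ae h0] with w hw
    simp [hw]
  · have hc := one_sub_overlap_ne_zero μ ν h
    have h' : overlap ν μ ≠ 1 := overlap_comm μ ν ▸ h
    rw [excessLaw, if_neg h, excessLaw, if_neg h', refMeasure_comm ν μ,
      prod_withDensity (by fun_prop) (by fun_prop), ← withDensity_smul _ (by fun_prop),
      overlap_comm ν μ]
    congr with w
    rw [Pi.smul_apply, smul_eq_mul, ← mul_assoc, ENNReal.mul_div_cancel hc (by simp), mul_div_assoc]

lemma ite_eq_pairLaw {p : Prop} [Decidable p] (hp : p → μ = ν) :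
    (if p then μ.map (fun u => (u, u))
      else ((refMeasure μ ν).prod (refMeasure μ ν)).withDensity
          (fun w => excessDensity μ ν w.1 * excessDensity ν μ w.2 / (1 - overlap μ ν))
        + ((refMeasure μ ν).withDensity (minDensity μ ν)).map fun u => (u, u)) =
      pairLaw μ ν := by
  split_ifs with h
  · obtain rfl := hp h
    exact (pairLaw_self μ).symm
  · rw [withDensity_excess_mul_excess]
    rfl

/-- The selector is independent of the other three variables, so conditioning on its value gives a
mixture of the independent pair and the diagonal pair. -/
lemma map_compPair_prod_bernoulliLaw (ρ : Measure S) [IsProbabilityMeasure ρ]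
    {a : ℝ≥0∞} (ha : a ≤ 1) :
    (μ.prod (ν.prod (ρ.prod (bernoulliLaw a)))).map compPair =
      (1 - a) • μ.prod ν + a • ρ.map fun u => (u, u) := by
  refine Measure.ext_of_lintegral _ fun f hf => ?_
  rw [lintegral_map hf measurable_compPair,
    lintegral_prod_bernoulliLaw μ ν ρ ha (f := fun y => f (compPair y)) (hf.comp measurable_compPair)]
  have h0 (x y z : S) : compPair (x, y, z, (0 : Fin 2)) = (z, z) := by simp [compPair, comp₁, comp₂]
  have h1 (x y z : S) : compPair (x, y, z, (1 : Fin 2)) = (x, y) := by simp [compPair, comp₁, comp₂]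
  simp only [h0, h1, lintegral_const, measure_univ, mul_one]
  rw [lintegral_add_measure, lintegral_smul_measure, lintegral_smul_measure,
    lintegral_map hf measurable_diag, lintegral_prod _ hf.aemeasurable, add_comm]
  rfl

end TwoMeasures

/-! ### Measurable dependence of the building blocks on the starting points. -/

section Kernels

variable {S : Type*} [MeasurableSpace S]

lemma measurable_smul_measure {Z : Type*} [MeasurableSpace Z] {c : Z → ℝ≥0∞} {ρ : Z → Measure S}
    (hc : Measurable c) (hρ : Measurable ρ) : Measurable fun z => c z • ρ z := by
  refine Measure.measurable_of_measurable_coe _ fun s hs => ?_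
  simp only [Measure.smul_apply, smul_eq_mul]
  exact hc.mul ((Measure.measurable_coe hs).comp hρ)

/-- The reference measure as a kernel. -/
noncomputable def refKernel (Q : Kernel S S) : Kernel (S × S) S where
  toFun z := refMeasure (Q z.1) (Q z.2)
  measurable' := by
    refine measurable_smul_measure measurable_const ?_
    refine Measure.measurable_of_measurable_coe _ fun s hs => ?_
    simp only [Measure.add_apply]
    exact ((Q.measurable_coe hs).comp measurable_fst).add
      ((Q.measurable_coe hs).comp measurable_snd)

instance isMarkovKernel_refKernel (Q : Kernel S S) [IsMarkovKernel Q] :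
    IsMarkovKernel (refKernel Q) :=
  ⟨fun z => isProbabilityMeasure_refMeasure (Q z.1) (Q z.2)⟩

/-- The densities `dQ_x / dΛ_{x,x'}` have versions that are jointly measurable in `(x, x', u)`. -/
def HasMeasurableDensity (Q : Kernel S S) : Prop :=
  ∃ g : S × S → S → ℝ≥0∞, Measurable (Function.uncurry g) ∧
    ∀ x x' : S, g (x, x') =ᵐ[refMeasure (Q x) (Q x')] (Q x).rnDeriv (refMeasure (Q x) (Q x'))

lemma HasMeasurableDensities.hasMeasurableDensity {P : ℕ → Kernel S S} {m : ℕ}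
    (hP : HasMeasurableDensities P m) (t : ℕ) : HasMeasurableDensity (transition P t m) := hP t

/-- The reference measure is symmetric in the two points, so swapping them in `g` gives a version of
the second density. -/
lemma HasMeasurableDensity.exists_minDensity {Q : Kernel S S} (hQ : HasMeasurableDensity Q) :
    ∃ g f : S × S → S → ℝ≥0∞, Measurable (Function.uncurry g) ∧ Measurable (Function.uncurry f) ∧
      ∀ z : S × S,
        g z =ᵐ[refKernel Q z] (Q z.1).rnDeriv (refMeasure (Q z.1) (Q z.2)) ∧
        f z =ᵐ[refKernel Q z] minDensity (Q z.1) (Q z.2) := by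
  obtain ⟨g, hg, hae⟩ := hQ
  refine ⟨g, fun z u => min (g z u) (g z.swap u), hg, hg.min (hg.comp (f := fun p : (S × S) × S =>
    (p.1.swap, p.2)) (by fun_prop)), fun z => ⟨hae z.1 z.2, ?_⟩⟩
  have h2 : g z.swap =ᵐ[refKernel Q z] (Q z.2).rnDeriv (refMeasure (Q z.1) (Q z.2)) := by
    have := hae z.2 z.1
    rwa [refMeasure_comm] at this
  filter_upwards [hae z.1 z.2, h2] with u h1 h2
  rw [minDensity, h2]
  exact congrArg (min · _) h1

variable {Q : Kernel S S} [IsMarkovKernel Q]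

/-- The pointwise-chosen `rnDeriv` need not be jointly measurable, but the measure it defines
depends only on the almost-everywhere class, so a measurable version suffices. -/
lemma measurable_withDensity_refKernel {f : S × S → S → ℝ≥0∞}
    (hf : Measurable (Function.uncurry f)) {k : S × S → S → ℝ≥0∞}
    (h : ∀ z, f z =ᵐ[refKernel Q z] k z) :
    Measurable fun z : S × S => (refMeasure (Q z.1) (Q z.2)).withDensity (k z) := by
  convert ((refKernel Q).withDensity f).measurable using 2 with z
  rw [Kernel.withDensity_apply _ hf]
  exact (withDensity_congr_ae (h z)).symm

lemma HasMeasurableDensity.measurable_commonPart (hQ : HasMeasurableDensity Q) :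
    Measurable fun z : S × S => commonPart (Q z.1) (Q z.2) := by
  obtain ⟨g, f, hg, hf, h⟩ := hQ.exists_minDensity
  exact measurable_withDensity_refKernel hf fun z => (h z).2

lemma HasMeasurableDensity.measurable_excessPart (hQ : HasMeasurableDensity Q) :
    Measurable fun z : S × S => excessPart (Q z.1) (Q z.2) := by
  obtain ⟨g, f, hg, hf, h⟩ := hQ.exists_minDensity
  exact measurable_withDensity_refKernel (hg.sub hf) fun z => (h z).1.sub (h z).2

lemma HasMeasurableDensity.measurable_overlap (hQ : HasMeasurableDensity Q) :
    Measurable fun z : S × S => overlap (Q z.1) (Q z.2) := by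
  simp only [overlap_eq_commonPart]
  exact (Measure.measurable_coe .univ).comp hQ.measurable_commonPart

lemma HasMeasurableDensity.measurable_commonLaw (hQ : HasMeasurableDensity Q) :
    Measurable fun z : S × S => commonLaw (Q z.1) (Q z.2) := by
  simp only [commonLaw_eq_smul]
  exact measurable_smul_measure hQ.measurable_overlap.inv hQ.measurable_commonPart

lemma HasMeasurableDensity.measurable_excessLaw (hQ : HasMeasurableDensity Q) :
    Measurable fun z : S × S => excessLaw (Q z.1) (Q z.2) := by
  classical
  have h : (fun z : S × S => excessLaw (Q z.1) (Q z.2)) = fun z =>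
      if overlap (Q z.1) (Q z.2) = 1 then Q z.1
      else (1 - overlap (Q z.1) (Q z.2))⁻¹ • excessPart (Q z.1) (Q z.2) := by
    ext1 z
    split_ifs with h
    · rw [excessLaw, if_pos h]
    · exact excessLaw_eq_smul _ _ h
  rw [h]
  exact Measurable.ite (hQ.measurable_overlap (measurableSet_singleton 1))
    (Q.measurable.comp measurable_fst)
    (measurable_smul_measure (measurable_const.sub hQ.measurable_overlap).inv
      hQ.measurable_excessPart)

lemma HasMeasurableDensity.measurable_commonLaw_comp (hQ : HasMeasurableDensity Q) {Z : Type*}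
    [MeasurableSpace Z] {f g : Z → S} (hf : Measurable f) (hg : Measurable g) :
    Measurable fun z => commonLaw (Q (f z)) (Q (g z)) :=
  Measurable.comp (g := fun z : S × S => commonLaw (Q z.1) (Q z.2)) (f := fun z => (f z, g z))
    hQ.measurable_commonLaw (hf.prodMk hg)

lemma HasMeasurableDensity.measurable_excessLaw_comp (hQ : HasMeasurableDensity Q) {Z : Type*}
    [MeasurableSpace Z] {f g : Z → S} (hf : Measurable f) (hg : Measurable g) :
    Measurable fun z => excessLaw (Q (f z)) (Q (g z)) :=
  Measurable.comp (g := fun z : S × S => excessLaw (Q z.1) (Q z.2)) (f := fun z => (f z, g z))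
    hQ.measurable_excessLaw (hf.prodMk hg)

lemma measurable_prod_measure {Z S' : Type*} [MeasurableSpace Z] [MeasurableSpace S']
    {ρ : Z → Measure S} {σ : Z → Measure S'} (hρ : Measurable ρ) (hσ : Measurable σ)
    [∀ z, IsProbabilityMeasure (ρ z)] [∀ z, IsProbabilityMeasure (σ z)] :
    Measurable fun z => (ρ z).prod (σ z) := by
  let κ : Kernel Z S := ⟨ρ, hρ⟩
  let η : Kernel Z S' := ⟨σ, hσ⟩
  have : IsMarkovKernel κ := ⟨fun z => inferInstanceAs (IsProbabilityMeasure (ρ z))⟩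
  have : IsMarkovKernel η := ⟨fun z => inferInstanceAs (IsProbabilityMeasure (σ z))⟩
  convert (κ ×ₖ η).measurable using 2 with z
  rw [Kernel.prod_apply]
  rfl

end Kernels

/-! ### One step of the four-component process. -/

section Coupling

variable {S : Type*} [MeasurableSpace S] (P : ℕ → Kernel S S) (m t : ℕ)

lemma eq_zero_of_ne_one {i : Fin 2} (h : i ≠ 1) : i = 0 := by lia

open scoped Classical in
/-- The law of `ξ` at time `t + m`, given the four values at time `t`. -/
noncomputable def thirdLaw (x : S × S × S × Fin 2) : Measure S :=
  if x.2.2.2 = 1 ∧ alpha P m t x.1 x.2.1 ≠ 0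
  then commonLaw (transition P t m x.1) (transition P t m x.2.1) else transition P t m x.2.2.1

/-- The probability of `ζ = 0` at time `t + m`, given the four values at time `t`. -/
noncomputable def successProb (x : S × S × S × Fin 2) : ℝ≥0∞ :=
  if x.2.2.2 = 1 then alpha P m t x.1 x.2.1 else 1

/-- The coupled case is Bernoulli with success probability 1, so both values of ζ fit one product
formula. -/
lemma couplingStep_eq (x : S × S × S × Fin 2) :
    couplingStep P m t x =
      (excessLaw (transition P t m x.1) (transition P t m x.2.1)).prod
        ((excessLaw (transition P t m x.2.1) (transition P t m x.1)).prod
          ((thirdLaw P m t x).prod (bernoulliLaw (successProb P m t x)))) := by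
  simp only [couplingStep, thirdLaw, successProb]
  congr
  split_ifs
  · rfl
  · exact bernoulliLaw_one.symm

variable [∀ t, IsMarkovKernel (P t)]

lemma alpha_le_one (x x' : S) : alpha P m t x x' ≤ 1 := overlap_le_one _ _

lemma successProb_le_one (x : S × S × S × Fin 2) : successProb P m t x ≤ 1 := by
  rw [successProb]
  split_ifs
  exacts [alpha_le_one _ _ _ _ _, le_rfl]

instance isProbabilityMeasure_thirdLaw (x : S × S × S × Fin 2) :
    IsProbabilityMeasure (thirdLaw P m t x) := by
  rw [thirdLaw]
  split_ifs with h
  · exact isProbabilityMeasure_commonLaw _ _ h.2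
  · infer_instance

instance isProbabilityMeasure_bernoulliLaw_successProb (x : S × S × S × Fin 2) :
    IsProbabilityMeasure (bernoulliLaw (successProb P m t x)) :=
  isProbabilityMeasure_bernoulliLaw (successProb_le_one P m t x)

instance isProbabilityMeasure_couplingStep (x : S × S × S × Fin 2) :
    IsProbabilityMeasure (couplingStep P m t x) := by
  rw [couplingStep_eq]
  infer_instance

lemma pairStep_eq (z : S × S) :
    pairStep P m t z = pairLaw (transition P t m z.1) (transition P t m z.2) :=
  by classical exact ite_eq_pairLaw _ _ fun h => by rw [h]

/-- The intertwining relation behind the Markov property of the pair. Before coupling, the mixture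
over the new ζ reassembles `pairLaw`; after coupling, the current pair is diagonal and `pairLaw` is
a transition probability carried to the diagonal. -/
lemma map_compPair_couplingStep (x : S × S × S × Fin 2) :
    (couplingStep P m t x).map compPair = pairStep P m t (compPair x) := by
  rw [couplingStep_eq, map_compPair_prod_bernoulliLaw _ _ _ (successProb_le_one P m t x),
    pairStep_eq]
  by_cases hx : x.2.2.2 = 1
  · simp only [successProb, thirdLaw, compPair, comp₁, comp₂, hx, if_true, true_and, pairLaw, alpha]
    congr 1
    rw [← overlap_smul_commonLaw, Measure.map_smul]
    split_ifs with h
    · rfl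
    -- At α = 0 the law of ξ is a different one, but it enters with weight 0.
    · rw [not_not.1 h, zero_smul, zero_smul]
  · simp only [successProb, thirdLaw, compPair, comp₁, comp₂, hx, if_false, false_and, pairLaw_self,
      tsub_self, zero_smul, one_smul, zero_add]

lemma map_fst_pairStep (z : S × S) : (pairStep P m t z).map Prod.fst = transition P t m z.1 := by
  rw [pairStep_eq, fst_pairLaw]

lemma map_snd_pairStep (z : S × S) : (pairStep P m t z).map Prod.snd = transition P t m z.2 := by
  rw [pairStep_eq, snd_pairLaw]

instance isProbabilityMeasure_pairStep (z : S × S) : IsProbabilityMeasure (pairStep P m t z) := by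
  rw [pairStep_eq]
  infer_instance

lemma map_compPair_couplingInit (μ₁ μ₂ : Measure S) [IsProbabilityMeasure μ₁]
    [IsProbabilityMeasure μ₂] : (couplingInit μ₁ μ₂).map compPair = pairLaw μ₁ μ₂ := by
  rw [couplingInit]
  split_ifs with h1 h0
  · obtain rfl := eq_of_overlap_eq_one _ _ h1
    rw [pairLaw_self, Measure.map_map measurable_compPair (by fun_prop)]
    rfl
  · rw [Measure.map_map measurable_compPair (by fun_prop), pairLaw, overlap_comm, h0,
      commonPart_eq_zero μ₁ μ₂ (overlap_comm μ₁ μ₂ ▸ h0), excessLaw_of_overlap_eq_zero _ _ h0,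
      excessLaw_of_overlap_eq_zero μ₁ μ₂ (overlap_comm μ₁ μ₂ ▸ h0), tsub_zero, one_smul,
      Measure.map_zero, add_zero]
    exact Measure.map_id
  · have := isProbabilityMeasure_commonLaw μ₁ μ₂ (overlap_comm μ₁ μ₂ ▸ h0)
    rw [map_compPair_prod_bernoulliLaw _ _ _ (overlap_le_one _ _), pairLaw, overlap_comm μ₂ μ₁,
      ← overlap_smul_commonLaw, Measure.map_smul]

instance isProbabilityMeasure_couplingInit (μ₁ μ₂ : Measure S) [IsProbabilityMeasure μ₁]
    [IsProbabilityMeasure μ₂] : IsProbabilityMeasure (couplingInit μ₁ μ₂) :=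
  ⟨by
    rw [← Set.preimage_univ (f := compPair), ← Measure.map_apply measurable_compPair .univ,
      map_compPair_couplingInit, measure_univ]⟩

variable {P m t}

lemma measurableSet_uncoupled : MeasurableSet {x : S × S × S × Fin 2 | x.2.2.2 = 1} :=
  measurableSet_eq_fun (by fun_prop) (by fun_prop)

lemma measurable_alpha_fst_snd (hQ : HasMeasurableDensity (transition P t m)) :
    Measurable fun x : S × S × S × Fin 2 => alpha P m t x.1 x.2.1 :=
  hQ.measurable_overlap.comp (measurable_fst.prodMk measurable_snd.fst)

lemma measurable_thirdLaw (hQ : HasMeasurableDensity (transition P t m)) :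
    Measurable (thirdLaw P m t) := by
  have h1 : MeasurableSet {x : S × S × S × Fin 2 | x.2.2.2 = 1 ∧ alpha P m t x.1 x.2.1 ≠ 0} :=
    measurableSet_uncoupled.inter
      ((measurable_alpha_fst_snd hQ) (measurableSet_singleton 0)).compl
  have h2 : Measurable fun x : S × S × S × Fin 2 =>
      commonLaw (transition P t m x.1) (transition P t m x.2.1) :=
    hQ.measurable_commonLaw_comp measurable_fst measurable_snd.fst
  have h3 : Measurable fun x : S × S × S × Fin 2 => transition P t m x.2.2.1 :=
    (transition P t m).measurable.comp measurable_snd.snd.fst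
  exact Measurable.ite h1 h2 h3

lemma measurable_bernoulliLaw_successProb (hQ : HasMeasurableDensity (transition P t m)) :
    Measurable fun x => bernoulliLaw (successProb P m t x) := by
  have hs : Measurable (successProb P m t) :=
    Measurable.ite measurableSet_uncoupled (measurable_alpha_fst_snd hQ) measurable_const
  exact (measurable_smul_measure hs measurable_const).add
    (measurable_smul_measure (measurable_const.sub hs) measurable_const)

lemma measurable_couplingStep (hQ : HasMeasurableDensity (transition P t m)) :
    Measurable (couplingStep P m t) := by
  have h1 : Measurable fun x : S × S × S × Fin 2 =>
      excessLaw (transition P t m x.1) (transition P t m x.2.1) :=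
    hQ.measurable_excessLaw_comp measurable_fst measurable_snd.fst
  have h2 : Measurable fun x : S × S × S × Fin 2 =>
      excessLaw (transition P t m x.2.1) (transition P t m x.1) :=
    hQ.measurable_excessLaw_comp measurable_snd.fst measurable_fst
  have h34 := measurable_prod_measure (measurable_thirdLaw hQ)
    (measurable_bernoulliLaw_successProb hQ)
  have h := measurable_prod_measure h1 (measurable_prod_measure h2 h34)
  exact (funext (couplingStep_eq P m t)) ▸ h

/-- `couplingStep` as a kernel. -/
noncomputable def couplingKernel (hQ : HasMeasurableDensity (transition P t m)) :
    Kernel (S × S × S × Fin 2) (S × S × S × Fin 2) :=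
  ⟨couplingStep P m t, measurable_couplingStep hQ⟩

instance isMarkovKernel_couplingKernel (hQ : HasMeasurableDensity (transition P t m)) :
    IsMarkovKernel (couplingKernel hQ) :=
  ⟨fun x => isProbabilityMeasure_couplingStep P m t x⟩

lemma measurable_pairStep (hQ : HasMeasurableDensity (transition P t m)) :
    Measurable (pairStep P m t) := by
  -- Any pair is the image of an uncoupled state; the third entry `z.1` is a dummy.
  have h : pairStep P m t = fun z : S × S => (couplingStep P m t (z.1, z.2, z.1, 1)).map compPair :=
    funext fun z => by
      rw [map_compPair_couplingStep]
      simp [compPair, comp₁, comp₂]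
  rw [h]
  exact (Measure.measurable_map _ measurable_compPair).comp
    ((measurable_couplingStep hQ).comp (by fun_prop))

/-- `pairStep` as a kernel. -/
noncomputable def pairKernel (hQ : HasMeasurableDensity (transition P t m)) :
    Kernel (S × S) (S × S) :=
  ⟨pairStep P m t, measurable_pairStep hQ⟩

instance isMarkovKernel_pairKernel (hQ : HasMeasurableDensity (transition P t m)) :
    IsMarkovKernel (pairKernel hQ) :=
  ⟨fun x => isProbabilityMeasure_pairStep P m t x⟩

variable (P m t)

lemma lintegral_couplingStep_excess {h : S × S → ℝ≥0∞} (hh : Measurable h)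
    (x : S × S × S × Fin 2) :
    ∫⁻ y, h (y.1, y.2.1) ∂couplingStep P m t x =
      ∫⁻ u, ∫⁻ v, h (u, v) ∂excessLaw (transition P t m x.2.1) (transition P t m x.1)
        ∂excessLaw (transition P t m x.1) (transition P t m x.2.1) := by
  rw [couplingStep_eq, lintegral_prod_bernoulliLaw _ _ _ (successProb_le_one P m t x)
    (f := fun y => h (y.1, y.2.1)) (by fun_prop)]
  simp only [lintegral_const, measure_univ, mul_one]
  rw [← add_mul, add_tsub_cancel_of_le (successProb_le_one P m t x), one_mul]

/-- The new ζ is independent of the new η's, so remaining uncoupled contributes the factor 1 - α.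
The state on the right has dummy last entries, which makes the integral a function of the η's alone.
-/
lemma lintegral_couplingStep_uncoupled {h : S × S → ℝ≥0∞} (hh : Measurable h)
    (x : S × S × S × Fin 2) :
    ∫⁻ y, (if y.2.2.2 = 1 then h (y.1, y.2.1) else 0) ∂couplingStep P m t x =
      if x.2.2.2 = 1 then (1 - alpha P m t x.1 x.2.1) *
        ∫⁻ y, h (y.1, y.2.1) ∂couplingStep P m t (x.1, x.2.1, x.1, 1) else 0 := by
  rw [lintegral_couplingStep_excess P m t hh, couplingStep_eq,
    lintegral_prod_bernoulliLaw _ _ _ (successProb_le_one P m t x)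
      (f := fun y => if y.2.2.2 = 1 then h (y.1, y.2.1) else 0)
      (Measurable.ite (measurableSet_eq_fun (by fun_prop) (by fun_prop)) (by fun_prop)
        (by fun_prop))]
  simp only [successProb, zero_ne_one, if_false, if_true, lintegral_const, measure_univ, mul_one,
    mul_zero, zero_add]
  split_ifs
  · rfl
  · rw [tsub_self, zero_mul]

end Coupling

/-! ### Coupling inequality, absorption, and the Markov property of the pair and its components. -/

section CouplingProcess

variable {S Ω : Type*} [MeasurableSpace S] [MeasurableSpace Ω] {P : ℕ → Kernel S S}
  [∀ t, IsMarkovKernel (P t)] {m : ℕ} {Pr : Measure Ω} [IsProbabilityMeasure Pr]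
  {Y : ℕ → Ω → S × S × S × Fin 2}

/-- The test function `h` of the η's is what lets the induction close: one step backwards replaces
it by (1 - α) times its mean after a step, again a function of the η's. -/
lemma lintegral_uncoupled_le (hP : HasMeasurableDensities P m)
    (hY : IsMarkovProcess (fun n => couplingStep P m (n * m)) Y Pr) (n : ℕ)
    {h : S × S → ℝ≥0∞} (hh : Measurable h) :
    ∫⁻ ω, (if (Y n ω).2.2.2 = 1 then h ((Y n ω).1, (Y n ω).2.1) else 0) ∂Pr ≤
      ∫⁻ ω, (∏ i ∈ Finset.range n, (1 - alpha P m (i * m) (Y i ω).1 (Y i ω).2.1)) *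
        h ((Y n ω).1, (Y n ω).2.1) ∂Pr := by
  have hQ (n : ℕ) : HasMeasurableDensity (transition P (n * m) m) := hP (n * m)
  have hY' : IsMarkovProcess (fun n x => couplingKernel (hQ n) x) Y Pr := hY
  have hα (i : ℕ) : Measurable fun z : S × S => 1 - alpha P m (i * m) z.1 z.2 :=
    measurable_const.sub (hQ i).measurable_overlap
  induction n generalizing h with
  | zero =>
    -- The product is empty and the indicator is at most 1. Discarding this indicator is the only
    -- inequality in the argument.
    refine lintegral_mono fun ω => ?_
    dsimp only
    split_ifs <;> simp
  | succ n ih =>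
    have hind : Measurable fun y : S × S × S × Fin 2 =>
        if y.2.2.2 = 1 then h (y.1, y.2.1) else 0 :=
      Measurable.ite (measurableSet_eq_fun (by fun_prop) (by fun_prop)) (by fun_prop)
        (by fun_prop)
    have hk : Measurable fun z : S × S =>
        ∫⁻ y, h (y.1, y.2.1) ∂couplingKernel (hQ n) (z.1, z.2, z.1, 1) :=
      (Measurable.lintegral_kernel (κ := couplingKernel (hQ n))
        (f := fun y => h (y.1, y.2.1)) (by fun_prop)).comp (by fun_prop)
    have hW : Measurable[past Y n] fun ω =>
        ∏ i ∈ Finset.range (n + 1), (1 - alpha P m (i * m) (Y i ω).1 (Y i ω).2.1) :=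
      Finset.measurable_fun_prod _ fun i hi => (hα i).comp
        ((measurable_fst.prodMk measurable_snd.fst).comp
          (measurable_past Y (Nat.lt_succ_iff.1 (Finset.mem_range.1 hi))))
    have h1 := hY'.lintegral_mul n (g := fun _ => 1) measurable_const hind
    have h2 := hY'.lintegral_mul n hW (h := fun y => h (y.1, y.2.1)) (by fun_prop)
    simp only [one_mul] at h1
    rw [h1, h2]
    refine (le_of_eq ?_).trans ((ih ((hα n).mul hk)).trans (le_of_eq ?_))
    · congr with ω
      exact lintegral_couplingStep_uncoupled P m (n * m) hh (Y n ω)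
    · congr with ω
      -- The factor 1 - α at time n joins the product, which therefore runs over all times up to n
      -- and is measurable with respect to the past at n.
      rw [Finset.prod_range_succ, mul_assoc]
      refine congrArg _ (congrArg ((1 - alpha P m (n * m) (Y n ω).1 (Y n ω).2.1) * ·) ?_)
      exact (lintegral_couplingStep_excess P m (n * m) hh _).trans
        (lintegral_couplingStep_excess P m (n * m) hh (Y n ω)).symm

omit [MeasurableSpace S] in
lemma comp_eq_of_coupled {y : S × S × S × Fin 2} (hy : y.2.2.2 = 0) : comp₁ y = comp₂ y := by
  simp [comp₁, comp₂, hy]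

lemma measure_comp_ne_le (hP : HasMeasurableDensities P m)
    (hY : IsMarkovProcess (fun n => couplingStep P m (n * m)) Y Pr) (n : ℕ) :
    Pr {ω | comp₁ (Y n ω) ≠ comp₂ (Y n ω)} ≤
      ∫⁻ ω, ∏ i ∈ Finset.range n, (1 - alpha P m (i * m) (Y i ω).1 (Y i ω).2.1) ∂Pr := by
  have hmeas : MeasurableSet {ω | (Y n ω).2.2.2 = 1} :=
    (hY.measurable n).snd.snd.snd (measurableSet_singleton 1)
  have hsub : {ω | comp₁ (Y n ω) ≠ comp₂ (Y n ω)} ⊆ {ω | (Y n ω).2.2.2 = 1} := fun ω hω => by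
    by_contra h
    exact hω (comp_eq_of_coupled (eq_zero_of_ne_one h))
  have hle := lintegral_uncoupled_le hP hY n (h := fun _ => 1) measurable_const
  simp only [mul_one] at hle
  -- Monotonicity holds for outer measure, so the event of disagreement need not be measurable; only
  -- {ζ = 1} has to be.
  refine (measure_mono hsub).trans (le_trans (le_of_eq ?_) hle)
  rw [← lintegral_indicator_one hmeas]
  congr with ω
  simp [Set.indicator_apply]

/-- From ζ = 0 a step reaches ζ = 1 with probability 0, so the expectation of the product of the two
indicators vanishes. -/
lemma ae_coupled_succ (hP : HasMeasurableDensities P m)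
    (hY : IsMarkovProcess (fun n => couplingStep P m (n * m)) Y Pr) (n : ℕ) :
    ∀ᵐ ω ∂Pr, (Y n ω).2.2.2 = 0 → (Y (n + 1) ω).2.2.2 = 0 := by
  have hQ (n : ℕ) : HasMeasurableDensity (transition P (n * m) m) := hP (n * m)
  have hY' : IsMarkovProcess (fun n x => couplingKernel (hQ n) x) Y Pr := hY
  have hind (i : Fin 2) : Measurable fun y : S × S × S × Fin 2 =>
      if y.2.2.2 = i then (1 : ℝ≥0∞) else 0 :=
    Measurable.ite (measurableSet_eq_fun (by fun_prop) (by fun_prop)) measurable_const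
      measurable_const
  have h0 := hY'.lintegral_mul n ((hind 0).comp (measurable_past Y le_rfl)) (hind 1)
  have hz : ∫⁻ ω, (if (Y n ω).2.2.2 = 0 then (1 : ℝ≥0∞) else 0) *
      (if (Y (n + 1) ω).2.2.2 = 1 then (1 : ℝ≥0∞) else 0) ∂Pr = 0 := by
    refine h0.trans (lintegral_eq_zero_of_ae_eq_zero (.of_forall fun ω => ?_))
    have h := lintegral_couplingStep_uncoupled P m (n * m) (h := fun _ => 1) measurable_const
      (Y n ω)
    by_cases hω : (Y n ω).2.2.2 = 0
    · rw [if_neg (by simp [hω])] at h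
      exact mul_eq_zero_of_right _ h
    · simp [hω]
  have hmul : Measurable fun ω => (if (Y n ω).2.2.2 = 0 then (1 : ℝ≥0∞) else 0) *
      (if (Y (n + 1) ω).2.2.2 = 1 then (1 : ℝ≥0∞) else 0) :=
    ((hind 0).comp (hY.measurable n)).mul ((hind 1).comp (hY.measurable (n + 1)))
  rw [lintegral_eq_zero_iff hmul] at hz
  filter_upwards [hz] with ω hω hn
  refine eq_zero_of_ne_one fun h => ?_
  simp [hn, h] at hω

omit [MeasurableSpace S] [MeasurableSpace Ω] in
lemma exists_le_of_couplingIndex_le {ω : Ω} {n : ℕ} (h : couplingIndex Y ω ≤ n) :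
    ∃ k ≤ n, (Y k ω).2.2.2 = 0 := by
  by_contra! hne
  -- If no index up to n had ζ = 0, the infimum would be at least n + 1, also when it is taken over
  -- the empty set.
  have : ((n + 1 : ℕ) : ℕ∞) ≤ couplingIndex Y ω :=
    le_iInf₂ fun k hk => Nat.cast_le.2 <| by
      by_contra hlt
      exact hne k (by lia) hk
  exact absurd (Nat.cast_le.1 (this.trans h)) (by lia)

lemma ae_comp_eq (hP : HasMeasurableDensities P m)
    (hY : IsMarkovProcess (fun n => couplingStep P m (n * m)) Y Pr) :
    ∀ᵐ ω ∂Pr, ∀ n : ℕ, couplingIndex Y ω ≤ n → comp₁ (Y n ω) = comp₂ (Y n ω) := by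
  filter_upwards [ae_all_iff.2 (ae_coupled_succ hP hY)] with ω hω n hn
  obtain ⟨k, hk, h0⟩ := exists_le_of_couplingIndex_le hn
  exact comp_eq_of_coupled (Nat.le_induction h0 (fun i _ hi => hω i hi) n hk)

lemma IsMarkovProcess.compPair (hP : HasMeasurableDensities P m)
    (hY : IsMarkovProcess (fun n => couplingStep P m (n * m)) Y Pr) :
    IsMarkovProcess (fun n => pairStep P m (n * m)) (fun n ω => compPair (Y n ω)) Pr :=
  IsMarkovProcess.comp (κ := fun n => couplingKernel (t := n * m) (hP.hasMeasurableDensity (n * m)))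
    (κ' := fun n => pairKernel (t := n * m) (hP.hasMeasurableDensity (n * m))) hY measurable_compPair
    fun n x => map_compPair_couplingStep P m (n * m) x

lemma IsMarkovProcess.comp₁ (hP : HasMeasurableDensities P m)
    (hY : IsMarkovProcess (fun n => couplingStep P m (n * m)) Y Pr) :
    IsMarkovProcess (fun n x => transition P (n * m) m x) (fun n ω => comp₁ (Y n ω)) Pr :=
  IsMarkovProcess.comp (κ := fun n => pairKernel (t := n * m) (hP.hasMeasurableDensity (n * m)))
    (κ' := fun n => transition P (n * m) m) (hY.compPair hP) measurable_fst
    fun n z => map_fst_pairStep P m (n * m) z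

lemma IsMarkovProcess.comp₂ (hP : HasMeasurableDensities P m)
    (hY : IsMarkovProcess (fun n => couplingStep P m (n * m)) Y Pr) :
    IsMarkovProcess (fun n x => transition P (n * m) m x) (fun n ω => comp₂ (Y n ω)) Pr :=
  IsMarkovProcess.comp (κ := fun n => pairKernel (t := n * m) (hP.hasMeasurableDensity (n * m)))
    (κ' := fun n => transition P (n * m) m) (hY.compPair hP) measurable_snd
    fun n z => map_snd_pairStep P m (n * m) z

end CouplingProcess

end MarkovCoupling

/-! ### Assembly of the existence statement and the properties of the coupling. -/

theorem mainTheorem4 {S : Type u} [MeasurableSpace S]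
    (P : ℕ → Kernel S S) [∀ t, IsMarkovKernel (P t)]
    (m : ℕ) (hm : 1 ≤ m) (hP : MarkovCoupling.HasMeasurableDensities P m)
    (μ₁ μ₂ : Measure S) [IsProbabilityMeasure μ₁] [IsProbabilityMeasure μ₂]
    {Ω₁ : Type v₁} [MeasurableSpace Ω₁] (Pr₁ : Measure Ω₁) [IsProbabilityMeasure Pr₁]
    (X₁ : ℕ → Ω₁ → S) (hX₁ : MarkovCoupling.IsMarkovProcess (fun t x => P t x) X₁ Pr₁)
    (hX₁0 : Pr₁.map (X₁ 0) = μ₁)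
    {Ω₂ : Type v₂} [MeasurableSpace Ω₂] (Pr₂ : Measure Ω₂) [IsProbabilityMeasure Pr₂]
    (X₂ : ℕ → Ω₂ → S) (hX₂ : MarkovCoupling.IsMarkovProcess (fun t x => P t x) X₂ Pr₂)
    (hX₂0 : Pr₂.map (X₂ 0) = μ₂) :
    -- the four-component process exists
    (∃ (Ω : Type u) (_ : MeasurableSpace Ω) (Pr : Measure Ω) (_ : IsProbabilityMeasure Pr)
      (Y : ℕ → Ω → S × S × S × Fin 2),
      MarkovCoupling.IsMarkovProcess (fun n => MarkovCoupling.couplingStep P m (n * m)) Y Pr ∧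
        Pr.map (Y 0) = MarkovCoupling.couplingInit μ₁ μ₂) ∧
    -- every version `Y n = (η¹_{nm}, η²_{nm}, ξ_{nm}, ζ_{nm})` of it has the following properties
    ∀ {Ω : Type w} [MeasurableSpace Ω] (Pr : Measure Ω) [IsProbabilityMeasure Pr]
      (Y : ℕ → Ω → S × S × S × Fin 2),
      MarkovCoupling.IsMarkovProcess (fun n => MarkovCoupling.couplingStep P m (n * m)) Y Pr →
      Pr.map (Y 0) = MarkovCoupling.couplingInit μ₁ μ₂ →
      -- the one-dimensional laws agree
      (∀ n, IdentDistrib (fun ω => MarkovCoupling.comp₁ (Y n ω)) (X₁ (n * m)) Pr Pr₁) ∧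
      (∀ n, IdentDistrib (fun ω => MarkovCoupling.comp₂ (Y n ω)) (X₂ (n * m)) Pr Pr₂) ∧
      -- the laws on the space of trajectories agree
      IdentDistrib (fun ω n => MarkovCoupling.comp₁ (Y n ω)) (fun ω n => X₁ (n * m) ω) Pr Pr₁ ∧
      IdentDistrib (fun ω n => MarkovCoupling.comp₂ (Y n ω)) (fun ω n => X₂ (n * m) ω) Pr Pr₂ ∧
      -- each component is a Markov process with the transition probabilities of the chain
      MarkovCoupling.IsMarkovProcess (fun n x => MarkovCoupling.transition P (n * m) m x)
        (fun n ω => MarkovCoupling.comp₁ (Y n ω)) Pr ∧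
      MarkovCoupling.IsMarkovProcess (fun n x => MarkovCoupling.transition P (n * m) m x)
        (fun n ω => MarkovCoupling.comp₂ (Y n ω)) Pr ∧
      -- the pair is a Markov process with the explicit transition probability `pairStep`
      (∀ n z, IsProbabilityMeasure (MarkovCoupling.pairStep P m (n * m) z)) ∧
      MarkovCoupling.IsMarkovProcess (fun n => MarkovCoupling.pairStep P m (n * m))
        (fun n ω => (MarkovCoupling.comp₁ (Y n ω), MarkovCoupling.comp₂ (Y n ω))) Pr ∧
      -- the components coincide from the coupling time on
      (∀ᵐ ω ∂Pr, ∀ n : ℕ, MarkovCoupling.couplingIndex Y ω ≤ n →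
        MarkovCoupling.comp₁ (Y n ω) = MarkovCoupling.comp₂ (Y n ω)) ∧
      -- the coupling inequality
      (∀ n : ℕ, Pr {ω | MarkovCoupling.comp₁ (Y n ω) ≠ MarkovCoupling.comp₂ (Y n ω)} ≤
        ∫⁻ ω, ∏ i ∈ Finset.range n,
          (1 - MarkovCoupling.alpha P m (i * m) (Y i ω).1 (Y i ω).2.1) ∂Pr) := by
  open MarkovCoupling in
  refine ⟨?_, fun {Ω} _ Pr _ Y hY hY0 => ?_⟩
  · obtain ⟨Pr, hPr, hY, h0⟩ := exists_isMarkovProcess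
      (fun n => couplingKernel (t := n * m) (hP.hasMeasurableDensity (n * m))) (couplingInit μ₁ μ₂)
    exact ⟨_, _, Pr, hPr, _, hY, h0⟩
  · have hpair0 : Pr.map (fun ω => compPair (Y 0 ω)) = pairLaw μ₁ μ₂ := by
      rw [← map_compPair_couplingInit, ← hY0,
        Measure.map_map measurable_compPair (hY.measurable 0)]
      rfl
    have hm := (hY.compPair hP).measurable 0
    have h1 : Pr.map (fun ω => comp₁ (Y 0 ω)) = Pr₁.map (X₁ (0 * m)) := by
      rw [zero_mul, hX₁0, ← fst_pairLaw μ₁ μ₂, ← hpair0, Measure.map_map measurable_fst hm]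
      rfl
    have h2 : Pr.map (fun ω => comp₂ (Y 0 ω)) = Pr₂.map (X₂ (0 * m)) := by
      rw [zero_mul, hX₂0, ← snd_pairLaw μ₁ μ₂, ← hpair0, Measure.map_map measurable_snd hm]
      rfl
    have hd1 := IsMarkovProcess.identDistrib (κ := fun n => transition P (n * m) m)
      (hY.comp₁ hP) (hX₁.subsample m) h1
    have hd2 := IsMarkovProcess.identDistrib (κ := fun n => transition P (n * m) m)
      (hY.comp₂ hP) (hX₂.subsample m) h2
    -- The one-dimensional laws are coordinate projections of the trajectory laws.
    exact ⟨fun n => hd1.comp (measurable_pi_apply n), fun n => hd2.comp (measurable_pi_apply n),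
      hd1, hd2, hY.comp₁ hP, hY.comp₂ hP, fun n z => isProbabilityMeasure_pairStep P m (n * m) z,
      hY.compPair hP, ae_comp_eq hP hY, measure_comp_ne_le hP hY⟩
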